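/- Fix integers $n_u,n_v,m\ge 0$. For $w\in\{u,v\}$ let real numbers $\alpha_i^-\le\alpha_i^+$, $\beta_i^-\le\beta_i^+$ ($0\le i\le n_w$, depending on $w$) be given, and let $$\Delta_w=\Big\{\sum_{i=0}^{n_w}(\alpha_i+\mathrm{j}\beta_i)s^i \;:\; \alpha_i\in[\alpha_i^-,\alpha_i^+],\ \beta_i\in[\beta_i^-,\beta_i^+]\Big\},\qquad \mathrm{j}^2=-1,$$ be the corresponding complex interval polynomial family. Its eight Kharitonov polynomials $K_1^{\pm w},\dots,K_4^{\pm w}$ are the members of $\Delta_w$ whose coefficient of $s^i$ is $\alpha_i^{\pm}+\mathrm{j}\beta_i^{\pm}$, with the signs $(\text{sign for }\alpha_i,\ \text{sign for }\beta_i)$ depending only on $i \bmod 4$ and given, for $i\equiv 0,1,2,3 \pmod 4$ in this order, by $$\begin{array}{ll} K_1^{+w}: (-,-),(-,+),(+,+),(+,-) & \quad K_1^{-w}: (-,-),(+,-),(+,+),(-,+)\\ K_2^{+w}: (-,+),(+,+),(+,-),(-,-) & \quad K_2^{-w}: (-,+),(-,-),(+,-),(+,+)\\ K_3^{+w}: (+,-),(-,-),(-,+),(+,+)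 & \quad K_3^{-w}: (+,-),(+,+),(-,+),(-,-)\\ K_4^{+w}: (+,+),(+,-),(-,-),(-,+) & \quad K_4^{-w}: (+,+),(-,+),(-,-),(+,-) \end{array}$$ A polynomial is called Hurwitz stable if all its complex roots have negative real part (so the zero polynomial is not Hurwitz stable). Let $c_0,\dots,c_m\in\mathbb{C}$ and $F(p,q)=\sum_{k=0}^m c_k\,p^k q^{m-k}$. Suppose that all members of the family $\{F(\delta_u,\delta_v):\delta_u\in\Delta_u,\ \delta_v\in\Delta_v\}$ have the same degree (the zero polynomial having degree $-\infty$). Then every member of this family is Hurwitz stable if and only if the 32 polynomials $$F(K_i^{+u},K_j^{+v}),\qquad F(K_i^{-u},K_j^{-v}),\qquad i,j=1,2,3,4,$$ are all Hurwitz stable. -/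

import Mathlib

open Polynomial

/-- A complex polynomial is Hurwitz stable if all its roots lie in the open left half plane.
(The zero polynomial vanishes everywhere, so it is not Hurwitz stable.) -/
def HurwitzStable (p : ℂ[X]) : Prop :=
  ∀ z : ℂ, p.eval z = 0 → z.re < 0

/-- A family of polynomials is Hurwitz stable if all its members are. -/
def HurwitzStableFamily (P : Set ℂ[X]) : Prop :=
  ∀ p ∈ P, HurwitzStable p

/-- All members of the family have the same degree, where the zero polynomial has its own
degree `⊥`, different from that of the nonzero constants. -/
def HasFixedDegree (P : Set ℂ[X]) : Prop :=
  ∀ p ∈ P, ∀ q ∈ P, p.degree = q.degree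

/-- The two endpoints of an interval. -/
inductive Endpoint
  | lo
  | hi

/-- The coefficient bounds of a complex interval polynomial of order `n`: the real part of the
`i`-th coefficient ranges over `[reLo i, reHi i]`, the imaginary part over `[imLo i, imHi i]`. -/
structure ComplexIntervalBounds (n : ℕ) where
  reLo : Fin (n + 1) → ℝ
  reHi : Fin (n + 1) → ℝ
  imLo : Fin (n + 1) → ℝ
  imHi : Fin (n + 1) → ℝ
  re_le : ∀ i, reLo i ≤ reHi i
  im_le : ∀ i, imLo i ≤ imHi i

namespace ComplexIntervalBounds

variable {n : ℕ}

/-- The polynomial `∑ (α i + β i * I) X ^ i`. -/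
noncomputable def poly (α β : Fin (n + 1) → ℝ) : ℂ[X] :=
  ∑ i : Fin (n + 1), C ((α i : ℂ) + (β i : ℂ) * Complex.I) * X ^ (i : ℕ)

/-- The complex interval polynomial family with the given bounds. -/
def family (B : ComplexIntervalBounds n) : Set ℂ[X] :=
  {p | ∃ α β : Fin (n + 1) → ℝ,
    (∀ i, α i ∈ Set.Icc (B.reLo i) (B.reHi i)) ∧
    (∀ i, β i ∈ Set.Icc (B.imLo i) (B.imHi i)) ∧
    p = poly α β}

/-- The chosen endpoint of the interval of the real part of the `i`-th coefficient. -/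
def reEnd (B : ComplexIntervalBounds n) : Endpoint → Fin (n + 1) → ℝ
  | .lo => B.reLo
  | .hi => B.reHi

/-- The chosen endpoint of the interval of the imaginary part of the `i`-th coefficient. -/
def imEnd (B : ComplexIntervalBounds n) : Endpoint → Fin (n + 1) → ℝ
  | .lo => B.imLo
  | .hi => B.imHi

/-- The vertex polynomial whose coefficients follow two patterns of endpoints (for the real and
the imaginary parts) of period four in the index of the coefficient. -/
noncomputable def vertexPoly (B : ComplexIntervalBounds n) (a b : Fin 4 → Endpoint) : ℂ[X] :=
  poly (fun i => B.reEnd (a (Fin.ofNat 4 (i : ℕ))) i) (fun i => B.imEnd (b (Fin.ofNat 4 (i : ℕ))) i)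

/-- The Kharitonov polynomials `K₁⁺, K₂⁺, K₃⁺, K₄⁺` (indexed by `0, 1, 2, 3`). -/
noncomputable def kharitonovPlus (B : ComplexIntervalBounds n) : Fin 4 → ℂ[X] :=
  ![B.vertexPoly ![.lo, .lo, .hi, .hi] ![.lo, .hi, .hi, .lo],
    B.vertexPoly ![.lo, .hi, .hi, .lo] ![.hi, .hi, .lo, .lo],
    B.vertexPoly ![.hi, .lo, .lo, .hi] ![.lo, .lo, .hi, .hi],
    B.vertexPoly ![.hi, .hi, .lo, .lo] ![.hi, .lo, .lo, .hi]]

/-- The Kharitonov polynomials `K₁⁻, K₂⁻, K₃⁻, K₄⁻` (indexed by `0, 1, 2, 3`). -/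
noncomputable def kharitonovMinus (B : ComplexIntervalBounds n) : Fin 4 → ℂ[X] :=
  ![B.vertexPoly ![.lo, .hi, .hi, .lo] ![.lo, .lo, .hi, .hi],
    B.vertexPoly ![.lo, .lo, .hi, .hi] ![.hi, .lo, .lo, .hi],
    B.vertexPoly ![.hi, .hi, .lo, .lo] ![.lo, .hi, .hi, .lo],
    B.vertexPoly ![.hi, .lo, .lo, .hi] ![.hi, .hi, .lo, .lo]]

end ComplexIntervalBounds

/-- The binary form `∑ c k * p ^ k * q ^ (m - k)`, `k = 0, …, m`, evaluated at two polynomials. -/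
noncomputable def binaryForm {m : ℕ} (c : Fin (m + 1) → ℂ) (p q : ℂ[X]) : ℂ[X] :=
  ∑ k : Fin (m + 1), C (c k) * p ^ (k : ℕ) * q ^ (m - (k : ℕ))

/-! The proof is by zero exclusion: roots move continuously in a family of fixed degree, so
stability spreads from one member once no member vanishes on the imaginary axis
(`HurwitzStable.of_path`). At a point `Iω` the value of `F(p, q)` depends only on those of `p` and
`q`, which lie in rectangles cornered by the plus polynomials if `ω ≥ 0` and by the minus ones if `ω
≤ 0`. Points of these rectangles are values of bilinear patches of the corners, so it suffices that
`F` is stable on pairs from the patches (`HurwitzStable.binaryForm_patch`). A patch is reached by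
segments whose increments are, all along the axis, purely imaginary or purely real. Over `ℂ` the
form splits into linear factors `a p + b q`; a zero of `F` on a segment is a zero of one factor,
whose end polynomials are stable as divisors of stable ones. Phase monotonicity then makes the
factor vanish identically (`segmentPoly_eq_zero_of_eval_eq_zero`), hence `F` too, against the fixed
degree. -/

/-! ### Phase of a stable polynomial along the imaginary axis -/

theorem HurwitzStable.ne_zero {p : ℂ[X]} (hp : HurwitzStable p) : p ≠ 0 := by
  rintro rfl
  simpa using hp 0 (by simp)

theorem HurwitzStable.of_dvd {p q : ℂ[X]} (hq : HurwitzStable q) (h : p ∣ q) :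
    HurwitzStable p := by
  obtain ⟨r, rfl⟩ := h
  intro z hz
  exact hq z (by simp [hz])

theorem HurwitzStable.eval_I_mul_ne_zero {p : ℂ[X]} (hp : HurwitzStable p) (ω : ℝ) :
    p.eval (Complex.I * ω) ≠ 0 := fun h => by
  simpa using hp _ h

theorem re_one_div_I_mul_sub_pos {z : ℂ} (hz : z.re < 0) (ω : ℝ) :
    0 < (1 / (Complex.I * ω - z)).re := by
  have hne : Complex.I * ω - z ≠ 0 := fun h => by
    have := congrArg Complex.re h
    simp at this
    linarith
  rw [one_div, Complex.inv_re]
  refine div_pos ?_ (Complex.normSq_pos.2 hne)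
  simpa using hz

theorem Complex.re_multiset_sum (s : Multiset ℂ) : s.sum.re = (s.map Complex.re).sum :=
  map_multiset_sum Complex.reAddGroupHom s

/-- The argument of a stable polynomial is nondecreasing along the imaginary axis, and strictly
increasing unless the polynomial is constant. -/
theorem HurwitzStable.im_logDeriv {p : ℂ[X]} (hp : HurwitzStable p) (ω : ℝ) :
    0 ≤ (Complex.I * (p.derivative.eval (Complex.I * ω) / p.eval (Complex.I * ω))).im ∧
    ((Complex.I * (p.derivative.eval (Complex.I * ω) / p.eval (Complex.I * ω))).im = 0 →
      p.natDegree = 0) := by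
  have hsp := IsAlgClosed.splits p
  have hpos : ∀ z ∈ p.roots, 0 < (1 / (Complex.I * ω - z)).re := fun z hz =>
    re_one_div_I_mul_sub_pos (hp z (mem_roots'.1 hz).2) ω
  -- The logarithmic derivative is the sum of `1 / (Iω - z)` over the roots, and each root in the
  -- left half plane contributes a positive real part.
  have him : (Complex.I * (p.derivative.eval (Complex.I * ω) / p.eval (Complex.I * ω))).im =
      (p.roots.map fun z => (1 / (Complex.I * ω - z)).re).sum := by
    rw [hsp.eval_derivative_div_eval_of_ne_zero (hp.eval_I_mul_ne_zero ω), Complex.I_mul_im,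
      Complex.re_multiset_sum, Multiset.map_map]
    rfl
  rw [him]
  have hnonneg : ∀ x ∈ p.roots.map fun z => (1 / (Complex.I * ω - z)).re, 0 ≤ x := by
    intro x hx
    obtain ⟨z, hz, rfl⟩ := Multiset.mem_map.1 hx
    exact (hpos z hz).le
  refine ⟨Multiset.sum_nonneg hnonneg, fun h0 => ?_⟩
  rw [hsp.natDegree_eq_card_roots, Multiset.card_eq_zero]
  refine Multiset.eq_zero_of_forall_notMem fun z hz => ?_
  have := Multiset.single_le_sum hnonneg _ (Multiset.mem_map_of_mem _ hz)
  rw [h0] at this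
  exact absurd (hpos z hz) (not_lt.2 this)

/-! ### Segments with an increment of constant direction -/

/-- The point of parameter `t` of the segment between two polynomials. -/
noncomputable def segmentPoly (p q : ℂ[X]) (t : ℝ) : ℂ[X] :=
  C ((1 - t : ℝ) : ℂ) * p + C (t : ℂ) * q

theorem eval_segmentPoly (p q : ℂ[X]) (t : ℝ) (z : ℂ) :
    (segmentPoly p q t).eval z = (1 - t) * p.eval z + t * q.eval z := by
  simp [segmentPoly]

@[simp]
theorem segmentPoly_zero (p q : ℂ[X]) : segmentPoly p q 0 = p := by
  simp [segmentPoly]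

@[simp]
theorem segmentPoly_one (p q : ℂ[X]) : segmentPoly p q 1 = q := by
  simp [segmentPoly]

/-- A curve that stays on a real line through the origin has its velocity on that line. -/
theorem im_I_mul_eval_derivative_div_eq_zero {g : ℂ[X]} {d : ℂ}
    (h : ∀ ω : ℝ, (g.eval (Complex.I * ω) / d).im = 0) (ω : ℝ) :
    (Complex.I * g.derivative.eval (Complex.I * ω) / d).im = 0 := by
  have h1 : HasDerivAt (fun x : ℝ => Complex.I * (x : ℂ)) Complex.I ω := by
    simpa using (Complex.ofRealCLM.hasDerivAt (x := ω)).const_mul Complex.I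
  have h2 := (((g.hasDerivAt (Complex.I * ω)).comp_of_eq ω h1 rfl).div_const d)
  have h3 := (Complex.imCLM.hasFDerivAt.comp_hasDerivAt ω h2)
  have h4 : (Complex.imCLM ∘ fun x : ℝ => ((fun y => eval y g) ∘ fun x : ℝ => Complex.I * (x : ℂ)) x / d)
      = fun _ => (0 : ℝ) := by
    funext x
    exact h x
  rw [h4] at h3
  have := h3.unique (hasDerivAt_const ω (0 : ℝ))
  rw [mul_comm]
  exact this

/-- If the difference of two stable polynomials keeps a constant direction along the imaginary
axis, then a polynomial of the segment between them that vanishes at a point of the imaginary axis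
vanishes identically. -/
theorem segmentPoly_eq_zero_of_eval_eq_zero {g₀ g₁ : ℂ[X]} (h₀ : HurwitzStable g₀)
    (h₁ : HurwitzStable g₁) {d : ℂ}
    (hd : ∀ ω : ℝ, ∃ r : ℝ, (g₁ - g₀).eval (Complex.I * ω) = r * d) {t : ℝ}
    (ht : t ∈ Set.Icc (0 : ℝ) 1) {ω : ℝ} (hz : (segmentPoly g₀ g₁ t).eval (Complex.I * ω) = 0) :
    segmentPoly g₀ g₁ t = 0 := by
  have n₀ := h₀.eval_I_mul_ne_zero ω
  have n₁ := h₁.eval_I_mul_ne_zero ω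
  have hz' := hz
  rw [eval_segmentPoly] at hz
  obtain ⟨r, hr⟩ := hd ω
  rw [eval_sub] at hr
  -- A zero inside the segment puts the two end values on the line of `d`, on opposite sides of the
  -- origin.
  have e₀ : g₀.eval (Complex.I * ω) = (-(t * r) : ℝ) * d := by
    push_cast
    linear_combination hz - t * hr
  have e₁ : g₁.eval (Complex.I * ω) = ((1 - t) * r : ℝ) * d := by
    push_cast
    linear_combination hz + (1 - t) * hr
  have hd0 : d ≠ 0 := by
    rintro rfl
    exact n₀ (by simpa using e₀)
  have ht0 : 0 < t := lt_of_le_of_ne ht.1 fun h => n₀ (by rw [e₀, ← h]; simp)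
  have ht1 : t < 1 := lt_of_le_of_ne ht.2 fun h => n₁ (by rw [e₁, h]; simp)
  have hr0 : r ≠ 0 := fun h => n₀ (by rw [e₀, h]; simp)
  obtain ⟨p₀, c₀⟩ := h₀.im_logDeriv ω
  obtain ⟨p₁, c₁⟩ := h₁.im_logDeriv ω
  set A₀ := Complex.I * (g₀.derivative.eval (Complex.I * ω) / g₀.eval (Complex.I * ω)) with hA₀
  set A₁ := Complex.I * (g₁.derivative.eval (Complex.I * ω) / g₁.eval (Complex.I * ω)) with hA₁
  have key : (Complex.I * (g₁ - g₀).derivative.eval (Complex.I * ω) / d).im = 0 := by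
    refine im_I_mul_eval_derivative_div_eq_zero (fun x => ?_) ω
    obtain ⟨s, hs⟩ := hd x
    rw [hs, mul_div_cancel_right₀ _ hd0, Complex.ofReal_im]
  have b₀ : Complex.I * g₀.derivative.eval (Complex.I * ω) = A₀ * g₀.eval (Complex.I * ω) := by
    rw [hA₀]; field_simp
  have b₁ : Complex.I * g₁.derivative.eval (Complex.I * ω) = A₁ * g₁.eval (Complex.I * ω) := by
    rw [hA₁]; field_simp
  have hfr : Complex.I * (g₁ - g₀).derivative.eval (Complex.I * ω) / d =
      (((1 - t) * r : ℝ) : ℂ) * A₁ + ((t * r : ℝ) : ℂ) * A₀ := by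
    rw [derivative_sub, eval_sub, mul_sub, b₀, b₁, e₀, e₁]
    push_cast
    field_simp
    ring
  rw [hfr, Complex.add_im, Complex.im_ofReal_mul, Complex.im_ofReal_mul] at key
  -- The opposite signs of the end values turn the difference of velocities into a positive
  -- combination of the phase speeds. Both speeds are nonnegative, so both vanish and both ends are
  -- constant.
  have key' : (1 - t) * A₁.im + t * A₀.im = 0 := by
    apply mul_left_cancel₀ hr0
    linear_combination key
  have q₁ : 0 ≤ (1 - t) * A₁.im := mul_nonneg (by linarith) p₁
  have q₀ : 0 ≤ t * A₀.im := mul_nonneg ht0.le p₀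
  have z₀ : A₀.im = 0 := by
    rcases mul_eq_zero.1 (by linarith : t * A₀.im = 0) with h | h
    · exact absurd h ht0.ne'
    · exact h
  have z₁ : A₁.im = 0 := by
    rcases mul_eq_zero.1 (by linarith : (1 - t) * A₁.im = 0) with h | h
    · exact absurd h (by linarith)
    · exact h
  obtain ⟨x₀, hx₀⟩ := natDegree_eq_zero.1 (c₀ z₀)
  obtain ⟨x₁, hx₁⟩ := natDegree_eq_zero.1 (c₁ z₁)
  rw [← hx₀, ← hx₁, segmentPoly, ← C_mul, ← C_mul, ← C_add] at hz' ⊢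
  rw [eval_C] at hz'
  rw [hz', C_0]

/-! ### Continuity of roots and zero exclusion -/

/-- Every coefficient depends continuously on the parameter. -/
def ContinuousCoeff (f : ℝ → ℂ[X]) : Prop :=
  ∀ n, Continuous fun t => (f t).coeff n

namespace ContinuousCoeff

variable {f g : ℝ → ℂ[X]}

theorem const (p : ℂ[X]) : ContinuousCoeff fun _ => p := fun _ => continuous_const

theorem add (hf : ContinuousCoeff f) (hg : ContinuousCoeff g) :
    ContinuousCoeff fun t => f t + g t := fun n => by
  simp only [coeff_add]
  exact (hf n).add (hg n)

theorem mul (hf : ContinuousCoeff f) (hg : ContinuousCoeff g) :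
    ContinuousCoeff fun t => f t * g t := fun n => by
  simp only [coeff_mul]
  exact continuous_finsetSum _ fun x _ => (hf x.1).mul (hg x.2)

theorem pow (hf : ContinuousCoeff f) (k : ℕ) : ContinuousCoeff fun t => f t ^ k := by
  induction k with
  | zero => simpa using const 1
  | succ k ih => simpa only [pow_succ] using ih.mul hf

theorem sum {ι : Type*} (s : Finset ι) {f : ι → ℝ → ℂ[X]} (hf : ∀ i, ContinuousCoeff (f i)) :
    ContinuousCoeff fun t => ∑ i ∈ s, f i t := fun n => by
  simp only [finsetSum_coeff]
  exact continuous_finsetSum _ fun i _ => hf i n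

theorem segmentPoly (p q : ℂ[X]) : ContinuousCoeff (segmentPoly p q) := by
  intro n
  simp only [_root_.segmentPoly, coeff_add, coeff_C_mul]
  fun_prop

theorem binaryForm {m : ℕ} (c : Fin (m + 1) → ℂ) (hf : ContinuousCoeff f)
    (hg : ContinuousCoeff g) : ContinuousCoeff fun t => binaryForm c (f t) (g t) :=
  sum _ fun _ => ((const _).mul (hf.pow _)).mul (hg.pow _)

end ContinuousCoeff

/-- Otherwise every factor in the product over the roots has norm at least `r`. -/
theorem exists_isRoot_norm_sub_lt {p : ℂ[X]} {z : ℂ} {r : ℝ} (hr : 0 ≤ r)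
    (h : ‖p.eval z‖ < ‖p.leadingCoeff‖ * r ^ p.natDegree) :
    ∃ w, p.IsRoot w ∧ ‖z - w‖ < r := by
  by_contra! hcon
  refine absurd h (not_lt.2 ?_)
  have hsp := IsAlgClosed.splits p
  rw [hsp.eval_eq_prod_roots, norm_mul, hsp.natDegree_eq_card_roots]
  refine mul_le_mul_of_nonneg_left ?_ (norm_nonneg _)
  have hall : ∀ w ∈ p.roots, r ≤ ‖z - w‖ := fun w hw => hcon w (mem_roots'.1 hw).2
  generalize p.roots = s at hall
  induction s using Multiset.induction_on with
  | empty => simp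
  | cons a s ih =>
    rw [Multiset.card_cons, pow_succ', Multiset.map_cons, Multiset.prod_cons, norm_mul]
    exact mul_le_mul (hall a (by simp)) (ih fun w hw => hall w (by simp [hw])) (by positivity)
      (norm_nonneg _)

/-- Cauchy's bound with the maximum weakened to a sum, which is visibly continuous in the
coefficients. -/
theorem norm_lt_of_isRoot {p : ℂ[X]} (hp : p ≠ 0) {z : ℂ} (hz : p.IsRoot z) :
    ‖z‖ < (∑ i ∈ Finset.range p.natDegree, ‖p.coeff i‖) / ‖p.leadingCoeff‖ + 1 := by
  have h := hz.norm_lt_cauchyBound hp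
  have h2 : (Finset.range p.natDegree).sup (‖p.coeff ·‖₊) ≤
      ∑ i ∈ Finset.range p.natDegree, ‖p.coeff i‖₊ :=
    Finset.sup_le fun i hi => Finset.single_le_sum (f := fun i => ‖p.coeff i‖₊)
      (fun _ _ => zero_le) hi
  have h3 : ‖z‖₊ < (∑ i ∈ Finset.range p.natDegree, ‖p.coeff i‖₊) / ‖p.leadingCoeff‖₊ + 1 := by
    refine h.trans_le ?_
    unfold cauchyBound
    gcongr
  have h4 := NNReal.coe_lt_coe.2 h3
  push_cast at h4
  exact h4

/-- Along a path of polynomials of constant degree without roots on the imaginary axis, stability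
is preserved. -/
theorem HurwitzStable.of_path {f : ℝ → ℂ[X]} (hf : ContinuousCoeff f) (h₀ : HurwitzStable (f 0))
    (hdeg : ∀ t ∈ Set.Icc (0 : ℝ) 1, (f t).degree = (f 0).degree)
    (hne : ∀ t ∈ Set.Icc (0 : ℝ) 1, ∀ ω : ℝ, (f t).eval (Complex.I * ω) ≠ 0) :
    ∀ t ∈ Set.Icc (0 : ℝ) 1, HurwitzStable (f t) := by
  set d := (f 0).natDegree with hd
  have hnat : ∀ t ∈ Set.Icc (0 : ℝ) 1, (f t).natDegree = d := fun t ht =>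
    natDegree_eq_of_degree_eq (hdeg t ht)
  have hf0 : ∀ t ∈ Set.Icc (0 : ℝ) 1, f t ≠ 0 := fun t ht h0 =>
    hne t ht 0 (by simp [h0])
  have hlc : ∀ t ∈ Set.Icc (0 : ℝ) 1, (f t).coeff d ≠ 0 := fun t ht => by
    rw [← hnat t ht]
    exact leadingCoeff_ne_zero.2 (hf0 t ht)
  have heval : ∀ t ∈ Set.Icc (0 : ℝ) 1, ∀ z, (f t).eval z =
      ∑ i ∈ Finset.range (d + 1), (f t).coeff i * z ^ i := fun t ht z => by
    rw [eval_eq_sum_range, hnat t ht]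
  have hcont : Continuous fun x : ℝ × ℂ =>
      ∑ i ∈ Finset.range (d + 1), (f x.1).coeff i * x.2 ^ i :=
    continuous_finsetSum _ fun i _ => ((hf i).comp continuous_fst).mul (continuous_snd.pow i)
  -- The unstable parameters form a clopen subset of a connected interval. It is closed as the
  -- projection of a compact set, the roots being uniformly bounded. It is open because an unstable
  -- root has positive real part `z.re`, and nearby polynomials have a root within that distance of
  -- it.
  let B : Set unitInterval := {t | ∃ z : ℂ, 0 ≤ z.re ∧ (f t).eval z = 0}
  have hclosed : IsClosed B := by
    have hG : ContinuousOn (fun t => (∑ i ∈ Finset.range d, ‖(f t).coeff i‖) / ‖(f t).coeff d‖ + 1)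
        (Set.Icc (0 : ℝ) 1) := by
      refine ContinuousOn.add (ContinuousOn.div ?_ ?_ fun t ht => norm_ne_zero_iff.2 (hlc t ht))
        continuousOn_const
      · exact (continuous_finsetSum _ fun i _ => (hf i).norm).continuousOn
      · exact (hf d).norm.continuousOn
    obtain ⟨R, hR⟩ := (isCompact_Icc.image_of_continuousOn hG).bddAbove
    let S : Set (unitInterval × ℂ) := (Set.univ ×ˢ Metric.closedBall 0 R) ∩
      {x | 0 ≤ x.2.re ∧ ∑ i ∈ Finset.range (d + 1), (f x.1).coeff i * x.2 ^ i = 0}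
    have hS : IsCompact S := by
      refine (isCompact_univ.prod (isCompact_closedBall 0 R)).inter_right ?_
      refine (isClosed_le continuous_const (Complex.continuous_re.comp continuous_snd)).inter ?_
      exact isClosed_eq (hcont.comp
        ((continuous_subtype_val.comp continuous_fst).prodMk continuous_snd)) continuous_const
    have hBS : B = Prod.fst '' S := by
      ext t
      constructor
      · rintro ⟨z, hz, h0⟩
        refine ⟨(t, z), ⟨⟨trivial, ?_⟩, hz, ?_⟩, rfl⟩
        · rw [mem_closedBall_zero_iff]
          refine (norm_lt_of_isRoot (hf0 t t.2) h0).le.trans ?_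
          rw [leadingCoeff, hnat t t.2]
          exact hR ⟨t, t.2, rfl⟩
        · rw [← heval t t.2, h0]
      · rintro ⟨⟨s, z⟩, ⟨-, hz, h0⟩, rfl⟩
        exact ⟨z, hz, by rw [heval s s.2]; exact h0⟩
    rw [hBS]
    exact (hS.image continuous_fst).isClosed
  have hopen : IsOpen B := by
    rw [isOpen_iff_mem_nhds]
    rintro t ⟨z, hz, h0⟩
    have hz' : 0 < z.re := by
      refine lt_of_le_of_ne hz fun h => hne t t.2 z.im ?_
      rwa [show Complex.I * (z.im : ℂ) = z by apply Complex.ext <;> simp [← h]]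
    have c1 : Continuous fun s : unitInterval =>
        ‖∑ i ∈ Finset.range (d + 1), (f s).coeff i * z ^ i‖ :=
      (hcont.comp (continuous_subtype_val.prodMk continuous_const)).norm
    have c2 : Continuous fun s : unitInterval => ‖(f s).coeff d‖ * z.re ^ d :=
      ((hf d).comp continuous_subtype_val).norm.mul continuous_const
    have hlt : ‖∑ i ∈ Finset.range (d + 1), (f t).coeff i * z ^ i‖ < ‖(f t).coeff d‖ * z.re ^ d := by
      rw [← heval t t.2, h0, norm_zero]
      exact mul_pos (norm_pos_iff.2 (hlc t t.2)) (pow_pos hz' _)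
    filter_upwards [(isOpen_lt c1 c2).mem_nhds hlt] with s hs
    obtain ⟨w, hw, hzw⟩ := exists_isRoot_norm_sub_lt (p := f s) (z := z) hz (by
      rw [leadingCoeff, hnat s s.2, heval s s.2]
      exact hs)
    refine ⟨w, ?_, hw⟩
    have := (Complex.re_le_norm (z - w)).trans_lt hzw
    rw [Complex.sub_re] at this
    linarith
  rcases isClopen_iff.1 ⟨hclosed, hopen⟩ with h | h
  · intro t ht z hz
    by_contra! hcon
    have : (⟨t, ht⟩ : unitInterval) ∈ B := ⟨z, hcon, hz⟩
    rw [h] at this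
    exact this
  · obtain ⟨z, hz, h0⟩ : (0 : unitInterval) ∈ B := by rw [h]; trivial
    exact absurd (h₀ z h0) (not_lt.2 hz)

/-! ### Linear factors of a binary form -/

theorem eval_binaryForm {m : ℕ} (c : Fin (m + 1) → ℂ) (p q : ℂ[X]) (z : ℂ) :
    (binaryForm c p q).eval z =
      ∑ k : Fin (m + 1), c k * p.eval z ^ (k : ℕ) * q.eval z ^ (m - (k : ℕ)) := by
  simp [binaryForm, eval_finsetSum]

/-- Modulo `y p - x q`, `x ^ m` times the form is congruent to `F(x, y) p ^ m = 0`, and `y ^ m`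
times it to `F(x, y) q ^ m = 0`; one of `x ^ m`, `y ^ m` is a unit. -/
theorem mul_sub_mul_dvd_binaryForm {m : ℕ} {c : Fin (m + 1) → ℂ} {x y : ℂ} (hxy : x ≠ 0 ∨ y ≠ 0)
    (h : ∑ k : Fin (m + 1), c k * x ^ (k : ℕ) * y ^ (m - (k : ℕ)) = 0) (p q : ℂ[X]) :
    C y * p + C (-x) * q ∣ binaryForm c p q := by
  have hd : C y * p + C (-x) * q = C y * p - C x * q := by
    rw [C_neg]; ring
  rw [hd]
  have hpow : ∀ k : ℕ, C y * p - C x * q ∣ (C y * p) ^ k - (C x * q) ^ k := fun k =>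
    sub_dvd_pow_sub_pow _ _ k
  have hle : ∀ k : Fin (m + 1), (k : ℕ) + (m - k) = m := fun k => by omega
  rcases hxy with hx | hy
  · have hu : IsUnit (C (x ^ m) : ℂ[X]) := isUnit_C.2 (pow_ne_zero _ hx).isUnit
    rw [← hu.dvd_mul_left]
    have hz : ∑ k : Fin (m + 1), C (c k * x ^ (k : ℕ) * y ^ (m - (k : ℕ))) * p ^ m = 0 := by
      rw [← Finset.sum_mul, ← map_sum, h, C_0, zero_mul]
    rw [← sub_zero (C (x ^ m) * binaryForm c p q), ← hz, binaryForm, Finset.mul_sum,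
      ← Finset.sum_sub_distrib]
    refine Finset.dvd_sum fun k _ => ?_
    have e : C (x ^ m) * (C (c k) * p ^ (k : ℕ) * q ^ (m - (k : ℕ))) -
        C (c k * x ^ (k : ℕ) * y ^ (m - (k : ℕ))) * p ^ m =
        -(C (c k * x ^ (k : ℕ)) * p ^ (k : ℕ)) *
          ((C y * p) ^ (m - (k : ℕ)) - (C x * q) ^ (m - (k : ℕ))) := by
      have e1 : x ^ m = x ^ (k : ℕ) * x ^ (m - (k : ℕ)) := by rw [← pow_add, hle]
      have e2 : p ^ m = p ^ (k : ℕ) * p ^ (m - (k : ℕ)) := by rw [← pow_add, hle]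
      rw [e1, e2]
      simp only [C_mul, C_pow]
      ring
    rw [e]
    exact (hpow _).mul_left _
  · have hu : IsUnit (C (y ^ m) : ℂ[X]) := isUnit_C.2 (pow_ne_zero _ hy).isUnit
    rw [← hu.dvd_mul_left]
    have hz : ∑ k : Fin (m + 1), C (c k * x ^ (k : ℕ) * y ^ (m - (k : ℕ))) * q ^ m = 0 := by
      rw [← Finset.sum_mul, ← map_sum, h, C_0, zero_mul]
    rw [← sub_zero (C (y ^ m) * binaryForm c p q), ← hz, binaryForm, Finset.mul_sum,
      ← Finset.sum_sub_distrib]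
    refine Finset.dvd_sum fun k _ => ?_
    have e : C (y ^ m) * (C (c k) * p ^ (k : ℕ) * q ^ (m - (k : ℕ))) -
        C (c k * x ^ (k : ℕ) * y ^ (m - (k : ℕ))) * q ^ m =
        C (c k * y ^ (m - (k : ℕ))) * q ^ (m - (k : ℕ)) *
          ((C y * p) ^ (k : ℕ) - (C x * q) ^ (k : ℕ)) := by
      have e1 : y ^ m = y ^ (k : ℕ) * y ^ (m - (k : ℕ)) := by rw [← pow_add, hle]
      have e2 : q ^ m = q ^ (k : ℕ) * q ^ (m - (k : ℕ)) := by rw [← pow_add, hle]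
      rw [e1, e2]
      simp only [C_mul, C_pow]
      ring
    rw [e]
    exact (hpow _).mul_left _

theorem exists_binaryForm_zero {m : ℕ} (hm : m ≠ 0) (c : Fin (m + 1) → ℂ) :
    ∃ x y : ℂ, (x ≠ 0 ∨ y ≠ 0) ∧
      ∑ k : Fin (m + 1), c k * x ^ (k : ℕ) * y ^ (m - (k : ℕ)) = 0 := by
  by_cases hc : c (Fin.last m) = 0
  · refine ⟨1, 0, Or.inl one_ne_zero, Finset.sum_eq_zero fun k _ => ?_⟩
    rcases eq_or_ne k (Fin.last m) with rfl | hk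
    · simp [hc]
    · have : m - (k : ℕ) ≠ 0 := by
        have := Fin.val_lt_last hk
        omega
      simp [this]
  · let P : ℂ[X] := ∑ k : Fin (m + 1), C (c k) * X ^ (k : ℕ)
    have hcoeff : P.coeff m = c (Fin.last m) := by
      simp only [P, finsetSum_coeff, coeff_C_mul, coeff_X_pow]
      rw [Finset.sum_eq_single (Fin.last m)]
      · simp
      · intro k _ hk
        have := Fin.val_lt_last hk
        simp [this.ne']
      · simp
    have hdeg : P.degree ≠ 0 := fun h => by
      have h1 : (m : WithBot ℕ) ≤ P.degree := le_degree_of_ne_zero (by rwa [hcoeff])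
      rw [h] at h1
      exact hm (Nat.le_zero.1 (by exact_mod_cast h1))
    obtain ⟨x, hx⟩ := IsAlgClosed.exists_root P hdeg
    refine ⟨x, 1, Or.inr one_ne_zero, ?_⟩
    simpa [P, eval_finsetSum, IsRoot] using hx

/-- If the form has a nonzero value, every zero of the form lies on a line whose linear form
divides it. -/
theorem exists_linear_dvd_binaryForm {m : ℕ} {c : Fin (m + 1) → ℂ} {p₀ q₀ : ℂ[X]}
    (h₀ : binaryForm c p₀ q₀ ≠ 0) {x y : ℂ}
    (h : ∑ k : Fin (m + 1), c k * x ^ (k : ℕ) * y ^ (m - (k : ℕ)) = 0) :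
    ∃ a b : ℂ, a * x + b * y = 0 ∧ ∀ p q : ℂ[X], C a * p + C b * q ∣ binaryForm c p q := by
  by_cases hxy : x ≠ 0 ∨ y ≠ 0
  · exact ⟨y, -x, by ring, mul_sub_mul_dvd_binaryForm hxy h⟩
  -- At the origin every linear form vanishes, so any linear factor will do; one exists unless `m =
  -- 0`, where a zero would kill the form.
  · push Not at hxy
    obtain ⟨rfl, rfl⟩ := hxy
    have hm : m ≠ 0 := by
      rintro rfl
      apply h₀
      have hc : c 0 = 0 := by simpa using h
      simp [binaryForm, hc]
    obtain ⟨x, y, hxy, h'⟩ := exists_binaryForm_zero hm c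
    exact ⟨y, -x, by ring, mul_sub_mul_dvd_binaryForm hxy h'⟩

/-! ### Stability of the form along segments -/

/-- Closed under taking segments. -/
def SegmentClosed (P : Set ℂ[X]) : Prop :=
  ∀ p ∈ P, ∀ q ∈ P, ∀ t ∈ Set.Icc (0 : ℝ) 1, segmentPoly p q t ∈ P

section

variable {m : ℕ} {c : Fin (m + 1) → ℂ} {P Q : Set ℂ[X]}

theorem HurwitzStable.binaryForm_segment_of_ne_zero (hP : SegmentClosed P) (hQ : SegmentClosed Q)
    (hdeg : HasFixedDegree (Set.image2 (binaryForm c) P Q)) {p₀ p₁ q₀ q₁ : ℂ[X]}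
    (hp₀ : p₀ ∈ P) (hp₁ : p₁ ∈ P) (hq₀ : q₀ ∈ Q) (hq₁ : q₁ ∈ Q)
    (h₀ : HurwitzStable (binaryForm c p₀ q₀))
    (hne : ∀ t ∈ Set.Icc (0 : ℝ) 1, ∀ ω : ℝ,
      (binaryForm c (segmentPoly p₀ p₁ t) (segmentPoly q₀ q₁ t)).eval (Complex.I * ω) ≠ 0) :
    ∀ t ∈ Set.Icc (0 : ℝ) 1,
      HurwitzStable (binaryForm c (segmentPoly p₀ p₁ t) (segmentPoly q₀ q₁ t)) := by
  refine HurwitzStable.of_path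
    (.binaryForm c (.segmentPoly p₀ p₁) (.segmentPoly q₀ q₁)) (by simpa using h₀)
    (fun t ht => ?_) hne
  have hmem : ∀ s ∈ Set.Icc (0 : ℝ) 1, binaryForm c (segmentPoly p₀ p₁ s) (segmentPoly q₀ q₁ s) ∈
      Set.image2 (binaryForm c) P Q := fun s hs =>
    Set.mem_image2_of_mem (hP _ hp₀ _ hp₁ s hs) (hQ _ hq₀ _ hq₁ s hs)
  exact hdeg _ (hmem t ht) _ (hmem 0 (by simp))

/-- Stability of a form at the ends of a segment passes to the segment if each linear form in the
increments keeps a constant direction along the imaginary axis. -/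
theorem HurwitzStable.binaryForm_segment (hP : SegmentClosed P) (hQ : SegmentClosed Q)
    (hdeg : HasFixedDegree (Set.image2 (binaryForm c) P Q)) {p₀ p₁ q₀ q₁ : ℂ[X]}
    (hp₀ : p₀ ∈ P) (hp₁ : p₁ ∈ P) (hq₀ : q₀ ∈ Q) (hq₁ : q₁ ∈ Q)
    (h₀ : HurwitzStable (binaryForm c p₀ q₀)) (h₁ : HurwitzStable (binaryForm c p₁ q₁))
    (hdir : ∀ a b : ℂ, ∃ d : ℂ, ∀ ω : ℝ, ∃ r : ℝ,
      a * (p₁ - p₀).eval (Complex.I * ω) + b * (q₁ - q₀).eval (Complex.I * ω) = r * d) :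
    ∀ t ∈ Set.Icc (0 : ℝ) 1,
      HurwitzStable (binaryForm c (segmentPoly p₀ p₁ t) (segmentPoly q₀ q₁ t)) := by
  refine binaryForm_segment_of_ne_zero hP hQ hdeg hp₀ hp₁ hq₀ hq₁ h₀ fun t ht ω hz => ?_
  rw [eval_binaryForm] at hz
  obtain ⟨a, b, hab, hdvd⟩ := exists_linear_dvd_binaryForm h₀.ne_zero hz
  obtain ⟨d, hd⟩ := hdir a b
  have hseg : segmentPoly (C a * p₀ + C b * q₀) (C a * p₁ + C b * q₁) t =
      C a * segmentPoly p₀ p₁ t + C b * segmentPoly q₀ q₁ t := by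
    simp only [segmentPoly]
    ring
  have hzero : C a * segmentPoly p₀ p₁ t + C b * segmentPoly q₀ q₁ t = 0 := by
    rw [← hseg]
    refine segmentPoly_eq_zero_of_eval_eq_zero (h₀.of_dvd (hdvd p₀ q₀)) (h₁.of_dvd (hdvd p₁ q₁))
      (d := d) (fun x => ?_) ht (ω := ω) (by rw [hseg]; simpa using hab)
    obtain ⟨r, hr⟩ := hd x
    refine ⟨r, ?_⟩
    rw [← hr]
    simp only [eval_sub, eval_add, eval_mul, eval_C]
    ring
  have hF : binaryForm c (segmentPoly p₀ p₁ t) (segmentPoly q₀ q₁ t) = 0 :=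
    zero_dvd_iff.1 (hzero ▸ hdvd _ _)
  have := hdeg _ (Set.mem_image2_of_mem (hP _ hp₀ _ hp₁ t ht) (hQ _ hq₀ _ hq₁ t ht)) _
    (Set.mem_image2_of_mem hp₀ hq₀)
  rw [hF, degree_zero, eq_comm, degree_eq_bot] at this
  exact h₀.ne_zero this

theorem segmentPoly_self (p : ℂ[X]) (t : ℝ) : segmentPoly p p t = p := by
  rw [segmentPoly, ← add_mul, ← C_add]
  simp

/-- Only one argument moves, so the increment of `a p + b q` is `a` times that of `p` and keeps the
direction `a * d` for every factor. -/
theorem HurwitzStable.binaryForm_segment_left (hP : SegmentClosed P) (hQ : SegmentClosed Q)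
    (hdeg : HasFixedDegree (Set.image2 (binaryForm c) P Q)) {p₀ p₁ q : ℂ[X]}
    (hp₀ : p₀ ∈ P) (hp₁ : p₁ ∈ P) (hq : q ∈ Q) {d : ℂ}
    (hdir : ∀ ω : ℝ, ∃ r : ℝ, (p₁ - p₀).eval (Complex.I * ω) = r * d)
    (h₀ : HurwitzStable (binaryForm c p₀ q)) (h₁ : HurwitzStable (binaryForm c p₁ q))
    {t : ℝ} (ht : t ∈ Set.Icc (0 : ℝ) 1) :
      HurwitzStable (binaryForm c (segmentPoly p₀ p₁ t) q) := by
  have := binaryForm_segment hP hQ hdeg hp₀ hp₁ hq hq h₀ h₁ (fun a b => ⟨a * d, fun ω => by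
    obtain ⟨r, hr⟩ := hdir ω
    exact ⟨r, by rw [hr]; simp; ring⟩⟩) t ht
  rwa [segmentPoly_self] at this

theorem HurwitzStable.binaryForm_segment_right (hP : SegmentClosed P) (hQ : SegmentClosed Q)
    (hdeg : HasFixedDegree (Set.image2 (binaryForm c) P Q)) {p q₀ q₁ : ℂ[X]}
    (hp : p ∈ P) (hq₀ : q₀ ∈ Q) (hq₁ : q₁ ∈ Q) {d : ℂ}
    (hdir : ∀ ω : ℝ, ∃ r : ℝ, (q₁ - q₀).eval (Complex.I * ω) = r * d)
    (h₀ : HurwitzStable (binaryForm c p q₀)) (h₁ : HurwitzStable (binaryForm c p q₁))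
    {t : ℝ} (ht : t ∈ Set.Icc (0 : ℝ) 1) :
      HurwitzStable (binaryForm c p (segmentPoly q₀ q₁ t)) := by
  have := binaryForm_segment hP hQ hdeg hp hp hq₀ hq₁ h₀ h₁ (fun a b => ⟨b * d, fun ω => by
    obtain ⟨r, hr⟩ := hdir ω
    exact ⟨r, by rw [hr]; simp; ring⟩⟩) t ht
  rwa [segmentPoly_self] at this

/-! ### Rectangles of values and bilinear patches -/

/-- Four polynomials whose values, at each point of the imaginary axis, are the corners of a
rectangle with sides parallel to the axes. -/
structure IsRectangle (K : Fin 4 → ℂ[X]) : Prop where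
  re_eq_left : ∀ ω : ℝ, ((K 0).eval (Complex.I * ω)).re = ((K 1).eval (Complex.I * ω)).re
  re_eq_right : ∀ ω : ℝ, ((K 2).eval (Complex.I * ω)).re = ((K 3).eval (Complex.I * ω)).re
  im_eq_bot : ∀ ω : ℝ, ((K 0).eval (Complex.I * ω)).im = ((K 2).eval (Complex.I * ω)).im
  im_eq_top : ∀ ω : ℝ, ((K 1).eval (Complex.I * ω)).im = ((K 3).eval (Complex.I * ω)).im

/-- The point with parameters `s`, `t` of the bilinear patch with the given corners. -/
noncomputable def patch (K : Fin 4 → ℂ[X]) (s t : ℝ) : ℂ[X] :=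
  segmentPoly (segmentPoly (K 0) (K 1) t) (segmentPoly (K 2) (K 3) t) s

theorem SegmentClosed.patch_mem (hP : SegmentClosed P) {K : Fin 4 → ℂ[X]} (hK : ∀ i, K i ∈ P)
    {s t : ℝ} (hs : s ∈ Set.Icc (0 : ℝ) 1) (ht : t ∈ Set.Icc (0 : ℝ) 1) : patch K s t ∈ P :=
  hP _ (hP _ (hK 0) _ (hK 1) t ht) _ (hP _ (hK 2) _ (hK 3) t ht) s hs

theorem IsRectangle.direction_left {K : Fin 4 → ℂ[X]} (hK : IsRectangle K) (ω : ℝ) :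
    ∃ r : ℝ, (K 1 - K 0).eval (Complex.I * ω) = r * Complex.I :=
  ⟨((K 1 - K 0).eval (Complex.I * ω)).im, by
    apply Complex.ext <;> simp [hK.re_eq_left]⟩

theorem IsRectangle.direction_right {K : Fin 4 → ℂ[X]} (hK : IsRectangle K) (ω : ℝ) :
    ∃ r : ℝ, (K 3 - K 2).eval (Complex.I * ω) = r * Complex.I :=
  ⟨((K 3 - K 2).eval (Complex.I * ω)).im, by
    apply Complex.ext <;> simp [hK.re_eq_right]⟩

/-- Points dividing the left and right sides in the same ratio have equal height. -/
theorem IsRectangle.direction_across {K : Fin 4 → ℂ[X]} (hK : IsRectangle K) (t ω : ℝ) :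
    ∃ r : ℝ, (segmentPoly (K 2) (K 3) t - segmentPoly (K 0) (K 1) t).eval (Complex.I * ω) =
      r * (1 : ℂ) := by
  refine ⟨((segmentPoly (K 2) (K 3) t - segmentPoly (K 0) (K 1) t).eval (Complex.I * ω)).re, ?_⟩
  rw [mul_one]
  apply Complex.ext
  · simp
  · rw [Complex.ofReal_im, eval_sub, eval_segmentPoly, eval_segmentPoly, ← Complex.ofReal_one,
      ← Complex.ofReal_sub]
    simp only [Complex.sub_im, Complex.add_im, Complex.im_ofReal_mul, hK.im_eq_bot, hK.im_eq_top]
    ring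

/-- A form that is stable at the pairs of corners is stable at the pairs of points of the two
patches. -/
theorem HurwitzStable.binaryForm_patch (hP : SegmentClosed P) (hQ : SegmentClosed Q)
    (hdeg : HasFixedDegree (Set.image2 (binaryForm c) P Q)) {K L : Fin 4 → ℂ[X]}
    (hK : IsRectangle K) (hL : IsRectangle L) (hKP : ∀ i, K i ∈ P) (hLQ : ∀ i, L i ∈ Q)
    (h : ∀ i j, HurwitzStable (binaryForm c (K i) (L j))) {s t s' t' : ℝ}
    (hs : s ∈ Set.Icc (0 : ℝ) 1) (ht : t ∈ Set.Icc (0 : ℝ) 1)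
    (hs' : s' ∈ Set.Icc (0 : ℝ) 1) (ht' : t' ∈ Set.Icc (0 : ℝ) 1) :
    HurwitzStable (binaryForm c (patch K s t) (patch L s' t')) := by
  -- The first argument moves along both vertical sides and then across, against a fixed corner `L
  -- j`; then the second moves likewise.
  have h1 : ∀ j, HurwitzStable (binaryForm c (patch K s t) (L j)) := fun j =>
    binaryForm_segment_left hP hQ hdeg (hP _ (hKP 0) _ (hKP 1) t ht)
      (hP _ (hKP 2) _ (hKP 3) t ht) (hLQ j) (hK.direction_across t)
      (binaryForm_segment_left hP hQ hdeg (hKP 0) (hKP 1) (hLQ j) hK.direction_left (h 0 j) (h 1 j)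
        ht)
      (binaryForm_segment_left hP hQ hdeg (hKP 2) (hKP 3) (hLQ j) hK.direction_right (h 2 j)
        (h 3 j) ht) hs
  have hp := hP.patch_mem hKP hs ht
  exact binaryForm_segment_right hP hQ hdeg hp (hQ _ (hLQ 0) _ (hLQ 1) t' ht')
      (hQ _ (hLQ 2) _ (hLQ 3) t' ht') (hL.direction_across t')
      (binaryForm_segment_right hP hQ hdeg hp (hLQ 0) (hLQ 1) hL.direction_left (h1 0) (h1 1) ht')
      (binaryForm_segment_right hP hQ hdeg hp (hLQ 2) (hLQ 3) hL.direction_right (h1 2) (h1 3) ht')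
      hs'

theorem exists_mem_Icc_segment {a b x : ℝ} (h : x ∈ Set.Icc a b) :
    ∃ t ∈ Set.Icc (0 : ℝ) 1, (1 - t) * a + t * b = x := by
  rcases eq_or_lt_of_le (h.1.trans h.2) with rfl | hab
  · exact ⟨0, by simp, by linarith [h.1, h.2]⟩
  · refine ⟨(x - a) / (b - a), ⟨div_nonneg (by linarith [h.1]) (by linarith),
      (div_le_one (by linarith)).2 (by linarith [h.2])⟩, ?_⟩
    have : b - a ≠ 0 := by linarith
    field_simp
    ring

/-- The patch sweeps the whole rectangle. -/
theorem IsRectangle.exists_eval_patch_eq {K : Fin 4 → ℂ[X]} (hK : IsRectangle K) {ω : ℝ} {z : ℂ}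
    (hre : z.re ∈ Set.Icc ((K 0).eval (Complex.I * ω)).re ((K 3).eval (Complex.I * ω)).re)
    (him : z.im ∈ Set.Icc ((K 0).eval (Complex.I * ω)).im ((K 3).eval (Complex.I * ω)).im) :
    ∃ s ∈ Set.Icc (0 : ℝ) 1, ∃ t ∈ Set.Icc (0 : ℝ) 1,
      (patch K s t).eval (Complex.I * ω) = z := by
  obtain ⟨s, hs, es⟩ := exists_mem_Icc_segment hre
  obtain ⟨t, ht, et⟩ := exists_mem_Icc_segment him
  refine ⟨s, hs, t, ht, ?_⟩
  simp only [patch, eval_segmentPoly]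
  rw [← Complex.ofReal_one, ← Complex.ofReal_sub, ← Complex.ofReal_sub]
  apply Complex.ext
  · simp only [Complex.add_re, Complex.re_ofReal_mul, ← hK.re_eq_left, hK.re_eq_right]
    rw [← es]
    ring
  · simp only [Complex.add_im, Complex.im_ofReal_mul, ← hK.im_eq_bot, hK.im_eq_top]
    rw [← et]
    ring

end

/-! ### Values of the interval family and its Kharitonov polynomials -/

namespace ComplexIntervalBounds

variable {n : ℕ}

theorem eval_poly (α β : Fin (n + 1) → ℝ) (z : ℂ) :
    (poly α β).eval z =
      ∑ i : Fin (n + 1), ((α i : ℂ) + (β i : ℂ) * Complex.I) * z ^ (i : ℕ) := by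
  simp [poly, eval_finsetSum]

theorem segmentClosed_family (B : ComplexIntervalBounds n) : SegmentClosed B.family := by
  rintro _ ⟨α, β, hα, hβ, rfl⟩ _ ⟨α', β', hα', hβ', rfl⟩ t ht
  refine ⟨fun i => (1 - t) * α i + t * α' i, fun i => (1 - t) * β i + t * β' i, fun i => ?_,
    fun i => ?_, ?_⟩
  · exact convex_Icc _ _ (hα i) (hα' i) (by linarith [ht.2]) ht.1 (by ring)
  · exact convex_Icc _ _ (hβ i) (hβ' i) (by linarith [ht.2]) ht.1 (by ring)
  · simp only [segmentPoly, poly, Finset.mul_sum, ← Finset.sum_add_distrib]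
    refine Finset.sum_congr rfl fun i _ => ?_
    rw [← mul_assoc, ← mul_assoc, ← C_mul, ← C_mul, ← add_mul, ← C_add]
    congr 2
    push_cast
    ring

theorem reEnd_mem (B : ComplexIntervalBounds n) (e : Endpoint) (i : Fin (n + 1)) :
    B.reEnd e i ∈ Set.Icc (B.reLo i) (B.reHi i) := by
  cases e
  · exact ⟨le_rfl, B.re_le i⟩
  · exact ⟨B.re_le i, le_rfl⟩

theorem imEnd_mem (B : ComplexIntervalBounds n) (e : Endpoint) (i : Fin (n + 1)) :
    B.imEnd e i ∈ Set.Icc (B.imLo i) (B.imHi i) := by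
  cases e
  · exact ⟨le_rfl, B.im_le i⟩
  · exact ⟨B.im_le i, le_rfl⟩

theorem vertexPoly_mem (B : ComplexIntervalBounds n) (a b : Fin 4 → Endpoint) :
    B.vertexPoly a b ∈ B.family :=
  ⟨_, _, fun i => B.reEnd_mem _ i, fun i => B.imEnd_mem _ i, rfl⟩

theorem kharitonovPlus_mem (B : ComplexIntervalBounds n) (i : Fin 4) :
    B.kharitonovPlus i ∈ B.family := by
  fin_cases i <;> exact B.vertexPoly_mem _ _

theorem kharitonovMinus_mem (B : ComplexIntervalBounds n) (i : Fin 4) :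
    B.kharitonovMinus i ∈ B.family := by
  fin_cases i <;> exact B.vertexPoly_mem _ _

theorem re_eval_poly (α β : Fin (n + 1) → ℝ) (ω : ℝ) :
    ((poly α β).eval (Complex.I * ω)).re =
      ∑ i : Fin (n + 1), ω ^ (i : ℕ) *
        ![α i, -β i, -α i, β i] (Fin.ofNat 4 (i : ℕ)) := by
  rw [eval_poly, Complex.re_sum]
  refine Finset.sum_congr rfl fun i _ => ?_
  have hI : (Complex.I * (ω : ℂ)) ^ (i : ℕ) = ((ω ^ (i : ℕ) : ℝ) : ℂ) *
      Complex.I ^ ((i : ℕ) % 4) := by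
    rw [mul_pow, Complex.ofReal_pow, ← Complex.I_pow_eq_pow_mod, mul_comm]
  rw [hI, mul_left_comm, Complex.re_ofReal_mul]
  congr 1
  have h4 : (i : ℕ) % 4 < 4 := Nat.mod_lt _ (by norm_num)
  have hf : Fin.ofNat 4 (i : ℕ) = ⟨(i : ℕ) % 4, h4⟩ := rfl
  rw [hf]
  generalize (i : ℕ) % 4 = r at h4
  interval_cases r <;> simp [pow_succ]

theorem im_eval_poly (α β : Fin (n + 1) → ℝ) (ω : ℝ) :
    ((poly α β).eval (Complex.I * ω)).im =
      ∑ i : Fin (n + 1), ω ^ (i : ℕ) *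
        ![β i, α i, -β i, -α i] (Fin.ofNat 4 (i : ℕ)) := by
  rw [eval_poly, Complex.im_sum]
  refine Finset.sum_congr rfl fun i _ => ?_
  have hI : (Complex.I * (ω : ℂ)) ^ (i : ℕ) = ((ω ^ (i : ℕ) : ℝ) : ℂ) *
      Complex.I ^ ((i : ℕ) % 4) := by
    rw [mul_pow, Complex.ofReal_pow, ← Complex.I_pow_eq_pow_mod, mul_comm]
  rw [hI, mul_left_comm, Complex.im_ofReal_mul]
  congr 1
  have h4 : (i : ℕ) % 4 < 4 := Nat.mod_lt _ (by norm_num)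
  have hf : Fin.ofNat 4 (i : ℕ) = ⟨(i : ℕ) % 4, h4⟩ := rfl
  rw [hf]
  generalize (i : ℕ) % 4 = r at h4
  interval_cases r <;> simp [pow_succ]

/-- The real part sees only `α` at even and `β` at odd indices, the imaginary part the others, and
the sign patterns agree where needed. No sign of `ω` enters, so the directions are constant on the
whole axis. -/
theorem isRectangle_kharitonovPlus (B : ComplexIntervalBounds n) :
    IsRectangle B.kharitonovPlus := by
  constructor <;> intro ω <;>
  simp only [kharitonovPlus, vertexPoly, Matrix.cons_val, re_eval_poly, im_eval_poly] <;>
  refine Finset.sum_congr rfl fun i _ => ?_ <;>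
  generalize Fin.ofNat 4 (i : ℕ) = r <;>
  fin_cases r <;> rfl

theorem isRectangle_kharitonovMinus (B : ComplexIntervalBounds n) :
    IsRectangle B.kharitonovMinus := by
  constructor <;> intro ω <;>
  simp only [kharitonovMinus, vertexPoly, Matrix.cons_val, re_eval_poly, im_eval_poly] <;>
  refine Finset.sum_congr rfl fun i _ => ?_ <;>
  generalize Fin.ofNat 4 (i : ℕ) = r <;>
  fin_cases r <;> rfl

/-- Real and imaginary parts involve disjoint sets of coefficients, so one vertex minimises every
term of both and another maximises them. -/
theorem mem_rectangle_of_nonneg (B : ComplexIntervalBounds n) {p : ℂ[X]} (hp : p ∈ B.family)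
    {ω : ℝ} (hω : 0 ≤ ω) :
    (p.eval (Complex.I * ω)).re ∈ Set.Icc ((B.kharitonovPlus 0).eval (Complex.I * ω)).re
      ((B.kharitonovPlus 3).eval (Complex.I * ω)).re ∧
    (p.eval (Complex.I * ω)).im ∈ Set.Icc ((B.kharitonovPlus 0).eval (Complex.I * ω)).im
      ((B.kharitonovPlus 3).eval (Complex.I * ω)).im := by
  obtain ⟨α, β, hα, hβ, rfl⟩ := hp
  simp only [kharitonovPlus, vertexPoly, Matrix.cons_val, re_eval_poly, im_eval_poly]
  refine ⟨⟨?_, ?_⟩, ?_, ?_⟩ <;>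
  refine Finset.sum_le_sum fun i _ => mul_le_mul_of_nonneg_left ?_ (pow_nonneg hω _) <;>
  have h1 := hα i <;>
  have h2 := hβ i <;>
  generalize Fin.ofNat 4 (i : ℕ) = r <;>
  fin_cases r <;> simp [reEnd, imEnd, h1.1, h1.2, h2.1, h2.2]

theorem mem_rectangle_of_nonpos (B : ComplexIntervalBounds n) {p : ℂ[X]} (hp : p ∈ B.family)
    {ω : ℝ} (hω : ω ≤ 0) :
    (p.eval (Complex.I * ω)).re ∈ Set.Icc ((B.kharitonovMinus 0).eval (Complex.I * ω)).re
      ((B.kharitonovMinus 3).eval (Complex.I * ω)).re ∧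
    (p.eval (Complex.I * ω)).im ∈ Set.Icc ((B.kharitonovMinus 0).eval (Complex.I * ω)).im
      ((B.kharitonovMinus 3).eval (Complex.I * ω)).im := by
  obtain ⟨α, β, hα, hβ, rfl⟩ := hp
  simp only [kharitonovMinus, vertexPoly, Matrix.cons_val, re_eval_poly, im_eval_poly]
  -- Odd powers change sign, which is why the minus patterns swap endpoints at odd indices. The sign
  -- is written with period four to match the patterns.
  have hpow : ∀ i : ℕ, ω ^ i = (-ω) ^ i * ![1, -1, 1, -1] (Fin.ofNat 4 i) := by
    intro i
    have h4 : i % 4 < 4 := Nat.mod_lt _ (by norm_num)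
    have hf : Fin.ofNat 4 i = ⟨i % 4, h4⟩ := rfl
    have hs : (-1 : ℝ) ^ i = (-1) ^ (i % 4) := by
      conv_lhs => rw [← Nat.div_add_mod i 4, pow_add, pow_mul]
      norm_num
    rw [hf, neg_pow, hs, mul_comm, ← mul_assoc]
    generalize i % 4 = r at h4
    interval_cases r <;> norm_num
  simp only [hpow, mul_assoc]
  refine ⟨⟨?_, ?_⟩, ?_, ?_⟩ <;>
  refine Finset.sum_le_sum fun i _ =>
    mul_le_mul_of_nonneg_left ?_ (pow_nonneg (neg_nonneg.2 hω) _) <;>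
  have h1 := hα i <;>
  have h2 := hβ i <;>
  generalize Fin.ofNat 4 (i : ℕ) = r <;>
  fin_cases r <;> simp [reEnd, imEnd, h1.1, h1.2, h2.1, h2.2]

end ComplexIntervalBounds

/-! ### The Kharitonov criterion for the form -/

theorem theorem2 {nu nv m : ℕ} (U : ComplexIntervalBounds nu) (V : ComplexIntervalBounds nv)
    (c : Fin (m + 1) → ℂ)
    (hdeg : HasFixedDegree (Set.image2 (binaryForm c) U.family V.family)) :
    HurwitzStableFamily (Set.image2 (binaryForm c) U.family V.family) ↔
      (∀ i j : Fin 4, HurwitzStable (binaryForm c (U.kharitonovPlus i) (V.kharitonovPlus j))) ∧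
      (∀ i j : Fin 4, HurwitzStable (binaryForm c (U.kharitonovMinus i) (V.kharitonovMinus j))) := by
  constructor
  · exact fun h =>
      ⟨fun i j => h _ (Set.mem_image2_of_mem (U.kharitonovPlus_mem i) (V.kharitonovPlus_mem j)),
        fun i j => h _ (Set.mem_image2_of_mem (U.kharitonovMinus_mem i) (V.kharitonovMinus_mem j))⟩
  rintro ⟨hplus, hminus⟩
  have hU := U.segmentClosed_family
  have hV := V.segmentClosed_family
  have hne : ∀ p ∈ U.family, ∀ q ∈ V.family, ∀ ω : ℝ,
      (binaryForm c p q).eval (Complex.I * ω) ≠ 0 := by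
    intro p hp q hq ω
    rcases le_total 0 ω with hω | hω
    · obtain ⟨pr, pi⟩ := U.mem_rectangle_of_nonneg hp hω
      obtain ⟨qr, qi⟩ := V.mem_rectangle_of_nonneg hq hω
      obtain ⟨s, hs, t, ht, e⟩ := U.isRectangle_kharitonovPlus.exists_eval_patch_eq pr pi
      obtain ⟨s', hs', t', ht', e'⟩ := V.isRectangle_kharitonovPlus.exists_eval_patch_eq qr qi
      -- The patch points depend on `ω` and match `p` and `q` only at `Iω`, which is all that the
      -- value of the form needs.
      rw [eval_binaryForm, ← e, ← e', ← eval_binaryForm]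
      exact (HurwitzStable.binaryForm_patch hU hV hdeg U.isRectangle_kharitonovPlus
        V.isRectangle_kharitonovPlus U.kharitonovPlus_mem V.kharitonovPlus_mem hplus
        hs ht hs' ht').eval_I_mul_ne_zero ω
    · obtain ⟨pr, pi⟩ := U.mem_rectangle_of_nonpos hp hω
      obtain ⟨qr, qi⟩ := V.mem_rectangle_of_nonpos hq hω
      obtain ⟨s, hs, t, ht, e⟩ := U.isRectangle_kharitonovMinus.exists_eval_patch_eq pr pi
      obtain ⟨s', hs', t', ht', e'⟩ := V.isRectangle_kharitonovMinus.exists_eval_patch_eq qr qi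
      rw [eval_binaryForm, ← e, ← e', ← eval_binaryForm]
      exact (HurwitzStable.binaryForm_patch hU hV hdeg U.isRectangle_kharitonovMinus
        V.isRectangle_kharitonovMinus U.kharitonovMinus_mem V.kharitonovMinus_mem hminus
        hs ht hs' ht').eval_I_mul_ne_zero ω
  rintro _ ⟨p, hp, q, hq, rfl⟩
  have hp₀ := U.kharitonovPlus_mem 0
  have hq₀ := V.kharitonovPlus_mem 0
  -- Both arguments now move at once from a stable vertex pair; no direction condition is needed,
  -- since zeros on the axis are already excluded.
  simpa using HurwitzStable.binaryForm_segment_of_ne_zero hU hV hdeg hp₀ hp hq₀ hq (hplus 0 0)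
    (fun t ht => hne _ (hU _ hp₀ _ hp t ht) _ (hV _ hq₀ _ hq t ht)) 1 (by simp)
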